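/- Let $p$ be a prime number, $s\ge 0$ an integer, and $a\neq\pm1$ a squarefree integer (positive or negative). Let $K=\mathbb{Q}(\theta)$, where $\theta$ is a root of $x^{p^s}-a$, and let $d_K$ denote the discriminant of the number field $K$. Let $v_p$ denote the $p$-adic valuation on the nonzero integers, and put $r=v_p(a^{p-1}-1)-1$. Then $$d_K=(-1)^{\frac{(p^s-1)(p^s-2)}{2}}\,p^{\nu}\,a^{p^s-1},\qquad \nu=\begin{cases} s\,p^s-2\displaystyle\sum_{j=1}^{\min\{r,s\}}p^{s-j}, & r>0,\\[2mm] s\,p^s, & r\le 0.\end{cases}$$ In particular, for $p=2$ and $s=3$ (pure octic fields $K=\mathbb{Q}(\sqrt[8]{a})$), $$d_K=\begin{cases}-2^{24}a^7, & a\equiv 2,3 \pmod 4,\\ -2^{16}a^7, & a\equiv 5,13 \pmod{16},\\ -2^{12}a^7, & a\equiv 9 \pmod{16},\\ -2^{10}a^7, & a\equiv 1\pmod{16}.\end{cases}$$ -/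

import Mathlib

/-!
Write `n = p ^ s`. Since `a` is squarefree and not a unit, `X ^ n - a` is irreducible by
Eisenstein's criterion, and the powers of `θ` have discriminant
`± n ^ n * a ^ (n - 1)` (`discr_powers_eq`). The theorem amounts to the determination of the ring of
integers, hence of the index of `ℤ[θ]` in it.

*Maximality criterion.* Let `O` be an order, `I` a radical ideal of `O`, `π ∈ I`, and `v ∈ O` with
`v I ⊆ π O`. If `x` is integral and `π ^ k x ∈ O`, then `v ^ k x ∈ O`
(`pow_mul_mem_of_isRadical`): an integral equation for `x` shows that `π ^ k x` is nilpotent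
modulo `I`, so it lies in `I`, and one power of `π` can be traded for one of `v`. With `π = θ`,
`v = 1` this shows that `ℤ[θ]` is maximal at the primes dividing `a`, because `ℤ[θ] / θ = ℤ / a` is
reduced (`mem_adjoin_of_pow_mul_mem`). Only `p` is left, and only when `p ∤ a`.

*The order at `p`.* Suppose `p ∤ a` and `s > 0`. Then `a - a ^ n = p ^ (r + 1) * u` with `p ∤ u`
(`exists_sub_pow_eq`). Put `y_j = θ ^ p ^ (s - j) - a ^ p ^ (s - j)` (the value of `rung j`) and
`E_j = (y_0 / y_j) / p ^ j` (`quotElt`), so that `y_j E_j = (a - a ^ n) / p ^ j`. Let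
`m = min r s`. Because `y_j / y_{j+1} = y_{j+1} ^ (p - 1) + p (y_{j+1} g + c)` with an integer `c`
prime to `p`, the products `E_j E_k` are computed by induction on `j`
(`quotElt_succ_mul_quotElt`). It follows that `∑_{j ≤ m} ℤ[θ] E_j` is a ring `O`
(`quotAlg_le_quotSpan`) and that modulo `(θ - a, p)` each `E_j` is idempotent, except that
for `p = 2` the element `E_r` may satisfy `E_r ^ 2 = E_r + E_{r-1}`. In either case `z ^ (p ^ 2) = z`
holds in `O / (θ - a, p)`, which is therefore reduced (`comap_rootIdeal_isRadical`).

The criterion now gives maximality of `O` at `p` (`mem_quotAlg_of_isIntegral`). If `m = r`, then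
`E_r y_r = p u`, and it applies with `π = θ - a`, `v = u`. If `m = s`, then `θ - a` need not be a
uniformizer at all primes above `p`; it applies with `π = θ - a`, `v = E_s - c` and
with `π = p`, `v = E_s`, and these two `v` together with `p` generate the unit ideal.

*The discriminant.* Division with remainder by the monic polynomials `y_j / y_{j+1}` shows that `O` has
a `ℤ`-basis of monic polynomials of degrees `0, …, n - 1` in `θ`, divided by powers of `p`
(`quotBasis`), with exactly `p ^ (s - t)` members divided by at least `p ^ t`, for `1 ≤ t ≤ m`. The
triangular change of basis (`discr_triangular`) removes `2 ∑_{t ≤ m} p ^ (s - t)` from the exponent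
of `p` in the discriminant of `ℤ[θ]`.
-/

open Polynomial

/-! ### A criterion for maximality of an order -/

/-- An integral equation for `x` makes `π ^ k * x` nilpotent modulo `I`, so that a factor `π` can be
traded for a factor `v` whenever `v * I ⊆ π * O`. -/
theorem pow_mul_mem_of_isRadical {K : Type*} [Field K] (O : Subalgebra ℤ K) (I : Ideal O)
    (hI : I.IsRadical) (π v : O) (hπ : π ∈ I) (hπ0 : π ≠ 0)
    (hv : ∀ z ∈ I, ∃ w : O, v * z = π * w) (k : ℕ) (x : K) (hx : IsIntegral ℤ x)
    (hO : ∀ z : O, IsIntegral ℤ (z : K)) (h : (π : K) ^ k * x ∈ O) : (v : K) ^ k * x ∈ O := by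
  induction k generalizing x with
  | zero => simpa using h
  | succ k ih =>
    obtain ⟨f, hf, hfx⟩ := hx
    set z : O := ⟨(π : K) ^ (k + 1) * x, h⟩ with hz
    -- `z` is a root of the monic polynomial `f` with its roots scaled by `π ^ (k + 1)`
    have hz0 : eval z ((f.map (algebraMap ℤ O)).scaleRoots (π ^ (k + 1))) = 0 := by
      have h1 : eval₂ (algebraMap O K) x (f.map (algebraMap ℤ O)) = 0 := by
        rw [eval₂_map, ← IsScalarTower.algebraMap_eq]; exact hfx
      have h2 := scaleRoots_eval₂_eq_zero (s := π ^ (k + 1)) (algebraMap O K) h1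
      have h3 : algebraMap O K (π ^ (k + 1)) * x = algebraMap O K z := by simp [hz]
      rw [h3, eval₂_at_apply] at h2
      exact (FaithfulSMul.algebraMap_injective O K) (by rw [h2, map_zero])
    have hzI : z ∈ I := by
      by_cases hne : I = ⊤
      · rw [hne]; trivial
      have : Nontrivial (O ⧸ I) := Ideal.Quotient.nontrivial_iff.mpr hne
      apply hI
      refine ⟨(f.map (algebraMap ℤ O)).natDegree, ?_⟩
      have hfm : (f.map (algebraMap ℤ O)).Monic := hf.map _
      have h4 := congrArg (Ideal.Quotient.mk I) hz0
      rw [map_zero, ← eval_map_apply, map_scaleRoots _ _ _ (by rw [hfm.leadingCoeff]; simp), map_pow,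
        Ideal.Quotient.eq_zero_iff_mem.mpr hπ, zero_pow (Nat.succ_ne_zero k), scaleRoots_zero,
        (hfm.map _).leadingCoeff, one_smul, eval_pow, eval_X, hfm.natDegree_map, ← map_pow,
        Ideal.Quotient.eq_zero_iff_mem] at h4
      exact h4
    obtain ⟨w, hw⟩ := hv z hzI
    have hw' : (π : K) ^ k * ((v : K) * x) = w := by
      have h5 : (v : K) * ((π : K) ^ (k + 1) * x) = π * w := by
        simpa [hz] using congrArg (algebraMap O K) hw
      have h6 : (π : K) ≠ 0 := by simpa using hπ0
      apply mul_left_cancel₀ h6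
      rw [← h5]; ring
    have h7 := ih ((v : K) * x) ((hO v).mul ⟨f, hf, hfx⟩) (hw' ▸ w.2)
    have h8 : (v : K) ^ (k + 1) * x = (v : K) ^ k * (v * x) := by ring
    rw [h8]; exact h7

theorem isRadical_of_pow_sub_self_mem {R : Type*} [CommRing R] (I : Ideal R) {N : ℕ} (hN : 2 ≤ N)
    (h : ∀ x : R, x ^ N - x ∈ I) : I.IsRadical := by
  rintro x ⟨d, hd⟩
  have key : ∀ k, x ^ N ^ k - x ∈ I := by
    intro k
    induction k with
    | zero => simp
    | succ k ih =>
      have := I.add_mem (h (x ^ N ^ k)) ih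
      rw [← pow_mul, ← pow_succ] at this
      simpa using this
  have h1 : x ^ N ^ d ∈ I := I.pow_mem_of_pow_mem hd (Nat.lt_pow_self hN).le
  have := I.sub_mem h1 (key d)
  simpa using this

/-- In characteristic `p` the identity `x ^ p ^ k = x` needs to be checked on ring generators only. -/
theorem pow_sub_self_mem_of_adjoin_eq_top {R : Type*} [CommRing R] (I : Ideal R) {p : ℕ}
    (hp : p.Prime) (k : ℕ) (hpI : (p : R) ∈ I) (S : Set R) (hS : Algebra.adjoin ℤ S = ⊤)
    (h : ∀ x ∈ S, x ^ p ^ k - x ∈ I) (x : R) : x ^ p ^ k - x ∈ I := by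
  have hx : x ∈ Algebra.adjoin ℤ S := hS ▸ Algebra.mem_top
  induction hx using Algebra.adjoin_induction with
  | mem x hx => exact h x hx
  | algebraMap n =>
    have : (p : ℤ) ∣ n ^ p ^ k - n := by
      have := Fact.mk hp
      rw [← ZMod.intCast_zmod_eq_zero_iff_dvd]
      push_cast
      rw [ZMod.pow_card_pow, sub_self]
    obtain ⟨c, hc⟩ := this
    have h1 : algebraMap ℤ R n ^ p ^ k - algebraMap ℤ R n = p * algebraMap ℤ R c := by
      rw [← map_pow, ← map_sub, hc, map_mul]; simp
    rw [h1]; exact I.mul_mem_right _ hpI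
  | add x y _ _ hx hy =>
    obtain ⟨r, hr⟩ := exists_add_pow_prime_pow_eq hp x y k
    have : (x + y) ^ p ^ k - (x + y) = (x ^ p ^ k - x) + (y ^ p ^ k - y) + p * (x * y * r) := by
      rw [hr]; ring
    rw [this]
    exact I.add_mem (I.add_mem hx hy) (I.mul_mem_right _ hpI)
  | mul x y _ _ hx hy =>
    have : (x * y) ^ p ^ k - x * y = (x ^ p ^ k - x) * y ^ p ^ k + x * (y ^ p ^ k - y) := by ring
    rw [this]
    exact I.add_mem (I.mul_mem_right _ hx) (I.mul_mem_left _ hy)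

/-! ### The polynomials `X ^ p ^ (s - j) - a ^ p ^ (s - j)` and their quotients -/

/-- The polynomial `X ^ p ^ (s - j) - a ^ p ^ (s - j)`, meant for `j ≤ s`. Each divides the previous
one, and the last one is `X - a`. -/
noncomputable def rung (a : ℤ) (p s j : ℕ) : ℤ[X] := X ^ p ^ (s - j) - C (a ^ p ^ (s - j))

/-- The homogeneous geometric sum `rung (j - 1) / rung j`, for `1 ≤ j ≤ s`. -/
noncomputable def rungQuot (a : ℤ) (p s j : ℕ) : ℤ[X] :=
  ∑ l ∈ Finset.range p, (X ^ p ^ (s - j)) ^ l * C (a ^ p ^ (s - j)) ^ (p - 1 - l)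

/-- The product of the first `j` quotients, `rung 0 / rung j`. -/
noncomputable def rungProd (a : ℤ) (p s j : ℕ) : ℤ[X] := ∏ i ∈ Finset.range j, rungQuot a p s (i + 1)

section
variable {a : ℤ} {p s : ℕ}

theorem rung_mul_rungQuot {j : ℕ} (hj : j < s) :
    rung a p s (j + 1) * rungQuot a p s (j + 1) = rung a p s j := by
  have h : p ^ (s - j) = p ^ (s - (j + 1)) * p := by
    rw [← pow_succ]; congr 1; omega
  rw [rung, rungQuot, mul_comm, rung, (Commute.all _ _).geom_sum₂_mul, h, pow_mul, pow_mul, C_pow (n := p)]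

theorem rung_monic (hp : 0 < p) (j : ℕ) : (rung a p s j).Monic :=
  monic_X_pow_sub_C _ (pow_pos hp _).ne'

theorem natDegree_rung (j : ℕ) : (rung a p s j).natDegree = p ^ (s - j) :=
  natDegree_X_pow_sub_C

theorem rungQuot_monic (hp : 0 < p) {j : ℕ} (hj : j < s) : (rungQuot a p s (j + 1)).Monic :=
  (rung_monic hp (j + 1)).of_mul_monic_left (by rw [rung_mul_rungQuot hj]; exact rung_monic hp j)

theorem natDegree_rungQuot (hp : 0 < p) {j : ℕ} (hj : j < s) :
    p ^ (s - (j + 1)) + (rungQuot a p s (j + 1)).natDegree = p ^ (s - j) := by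
  rw [← natDegree_rung (a := a) j, ← rung_mul_rungQuot hj,
    (rung_monic hp _).natDegree_mul (rungQuot_monic hp hj), natDegree_rung]

theorem rungProd_succ (j : ℕ) : rungProd a p s (j + 1) = rungProd a p s j * rungQuot a p s (j + 1) :=
  Finset.prod_range_succ _ _

theorem rung_mul_rungProd {j : ℕ} (hj : j ≤ s) : rung a p s j * rungProd a p s j = rung a p s 0 := by
  induction j with
  | zero => simp [rungProd]
  | succ j ih =>
    rw [rungProd_succ, ← ih (by omega), ← rung_mul_rungQuot (show j < s by omega)]; ring

theorem rungProd_monic (hp : 0 < p) {j : ℕ} (hj : j ≤ s) : (rungProd a p s j).Monic :=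
  (rung_monic hp j).of_mul_monic_left (by rw [rung_mul_rungProd hj]; exact rung_monic hp 0)

theorem natDegree_rungProd (hp : 0 < p) {j : ℕ} (hj : j ≤ s) :
    p ^ (s - j) + (rungProd a p s j).natDegree = p ^ s := by
  have := natDegree_rung (a := a) (p := p) (s := s) 0
  rw [← rung_mul_rungProd hj, (rung_monic hp _).natDegree_mul (rungProd_monic hp hj),
    natDegree_rung] at this
  simpa using this

theorem rung_dvd_rung {i j : ℕ} (hij : i ≤ j) (hj : j ≤ s) : rung a p s j ∣ rung a p s i := by
  induction j, hij using Nat.le_induction with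
  | base => exact dvd_rfl
  | succ j hij ih => exact (Dvd.intro _ (rung_mul_rungQuot (by omega))).trans (ih (by omega))

theorem X_sub_C_dvd_rung (j : ℕ) : X - C a ∣ rung a p s j := by
  rw [rung, C_pow]; exact sub_dvd_pow_sub_pow _ _ _

/-- The quotient `((Y + b) ^ p - b ^ p) / Y` for `Y = rung (j + 1)`, with its leading term, constant
term and the rest separated. -/
theorem exists_rungQuot_eq (hp : p.Prime) {j : ℕ} (hj : j < s) : ∃ g : ℤ[X],
    rungQuot a p s (j + 1) = rung a p s (j + 1) ^ (p - 1) + C (p : ℤ) * (rung a p s (j + 1) * g) +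
      C (p : ℤ) * C ((a ^ p ^ (s - (j + 1))) ^ (p - 1)) := by
  obtain ⟨n, rfl⟩ : ∃ n, p = n + 2 := ⟨p - 2, by have := hp.two_le; omega⟩
  set Y := rung a (n + 2) s (j + 1) with hY
  set b := a ^ (n + 2) ^ (s - (j + 1)) with hb
  have h1 := add_pow_prime_eq hp Y (C b)
  have h2 : (Y + C b) ^ (n + 2) - C b ^ (n + 2) = Y * rungQuot a (n + 2) s (j + 1) := by
    rw [hY, rung_mul_rungQuot hj, rung, rung, sub_add_cancel, ← pow_mul, ← C_pow, hb, ← pow_mul,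
      ← pow_succ, show s - (j + 1) + 1 = s - j by omega]
  have h3 : Y ∣ (∑ k ∈ Finset.Ioo 0 (n + 2), Y ^ (k - 1) * C b ^ (n + 2 - k - 1) *
      (((n + 2).choose k / (n + 2) : ℕ) : ℤ[X])) - C b ^ n := by
    rw [← Finset.add_sum_erase _ _ (show 1 ∈ Finset.Ioo 0 (n + 2) by simp)]
    have : (n + 2).choose 1 / (n + 2) = 1 := by
      rw [Nat.choose_one_right]; exact Nat.div_self (by omega)
    rw [this]
    simp only [le_refl, tsub_eq_zero_of_le, pow_zero, one_mul, Nat.cast_one, mul_one]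
    rw [show n + 2 - 1 - 1 = n by omega, add_sub_cancel_left]
    refine Finset.dvd_sum fun k hk => ?_
    rw [Finset.mem_erase, Finset.mem_Ioo] at hk
    exact ((dvd_pow_self Y (by omega)).mul_right _).mul_right _
  obtain ⟨g, hg⟩ := h3
  refine ⟨C b * g, mul_left_cancel₀ (rung_monic (a := a) (s := s) hp.pos (j + 1)).ne_zero ?_⟩
  rw [← hY, ← h2, h1, eq_add_of_sub_eq hg]
  have h4 : ((n + 2 : ℕ) : ℤ[X]) = C (((n + 2 : ℕ) : ℤ)) := by simp
  rw [h4, show n + 2 - 1 = n + 1 by omega]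
  clear_value b
  rw [C_pow]
  ring

end

/-! ### Products of the elements `quotElt` -/

/-- The element `(rung 0 / rung j)(θ) / p ^ j`. It is integral when `p ^ (j + 1)` divides
`a - a ^ p ^ s`. -/
noncomputable def quotElt {K : Type*} [Field K] (a : ℤ) (p s : ℕ) (θ : K) (j : ℕ) : K :=
  aeval θ (rungProd a p s j) / (p : K) ^ j

section
variable {K : Type*} [Field K] {a : ℤ} {p s : ℕ} {θ : K}

theorem quotElt_zero : quotElt a p s θ 0 = 1 := by simp [quotElt, rungProd]

theorem p_mul_quotElt_succ [CharZero K] (hp : p ≠ 0) (j : ℕ) :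
    (p : K) * quotElt a p s θ (j + 1) = quotElt a p s θ j * aeval θ (rungQuot a p s (j + 1)) := by
  have : (p : K) ≠ 0 := by exact_mod_cast hp
  rw [quotElt, quotElt, rungProd_succ, map_mul, pow_succ]
  field_simp

theorem rung_mul_quotElt [CharZero K] (hp : p ≠ 0) (hθ : θ ^ p ^ s = (a : K)) {r : ℕ} {u : ℤ}
    (hu : a - a ^ p ^ s = p ^ (r + 1) * u) {j : ℕ} (hj : j ≤ s) (hjr : j ≤ r + 1) :
    aeval θ (rung a p s j) * quotElt a p s θ j = p ^ (r + 1 - j) * (u : K) := by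
  have hp' : (p : K) ≠ 0 := by exact_mod_cast hp
  have h0 : aeval θ (rung a p s 0) = (p : K) ^ (r + 1 - j) * p ^ j * u := by
    rw [← pow_add, Nat.sub_add_cancel hjr]
    have := congrArg (Int.cast : ℤ → K) hu
    push_cast at this
    rw [← this, rung]
    simp [hθ]
  rw [quotElt, mul_div_assoc', ← map_mul, rung_mul_rungProd hj, h0]
  field_simp

/-- The product of two of the elements `quotElt`, up to an error that is divisible by
`quotElt j`. The cofactor `W` is `rung (j + 1) / rung k`. -/
theorem quotElt_succ_mul_quotElt [CharZero K] (hp : p.Prime) (hθ : θ ^ p ^ s = (a : K)) {r : ℕ} {u : ℤ}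
    (hu : a - a ^ p ^ s = p ^ (r + 1) * u) {j k : ℕ} (hjk : j + 1 ≤ k) (hk : k ≤ s) (hkr : k ≤ r)
    {W : ℤ[X]} (hW : rung a p s (j + 1) = rung a p s k * W) : ∃ G : ℤ[X],
    quotElt a p s θ (j + 1) * quotElt a p s θ k =
      (a : K) ^ (p ^ (s - (j + 1)) * (p - 1)) * (quotElt a p s θ j * quotElt a p s θ k) +
      quotElt a p s θ j * aeval θ (rung a p s (j + 1) ^ (p - 2) * W * C ((p : ℤ) ^ (r - k) * u) +
        C (p : ℤ) * G) := by
  obtain ⟨g, hg⟩ := exists_rungQuot_eq (a := a) hp (show j < s by omega)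
  refine ⟨g * W * C ((p : ℤ) ^ (r - k) * u), ?_⟩
  have hp' : (p : K) ≠ 0 := by exact_mod_cast hp.ne_zero
  apply mul_left_cancel₀ hp'
  rw [← mul_assoc, p_mul_quotElt_succ hp.ne_zero, hg]
  have h1 := rung_mul_quotElt hp.ne_zero hθ hu hk (show k ≤ r + 1 by omega)
  rw [show r + 1 - k = r - k + 1 by omega] at h1
  have h2 : aeval θ (rung a p s (j + 1)) * quotElt a p s θ k = aeval θ W * (p ^ (r - k + 1) * u) := by
    rw [hW, map_mul, ← h1]; ring
  rw [show p - 1 = p - 2 + 1 by have := hp.two_le; omega]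
  simp only [map_mul, map_add, map_pow, eq_intCast, map_intCast, map_natCast,
    ← pow_mul]
  set Y := aeval θ (rung a p s (j + 1))
  set Ek := quotElt a p s θ k
  set Ej := quotElt a p s θ j
  linear_combination (Ej * Y ^ (p - 2) + Ej * p * aeval θ g) * h2

/-- The quotient of two rungs lies in the ideal `(X - a, p)`. -/
theorem rungQuot_eq_add (hp : p.Prime) {j : ℕ} (hj : j < s) : ∃ A B : ℤ[X],
    rungQuot a p s (j + 1) = (X - C a) * A + C (p : ℤ) * B := by
  obtain ⟨g, hg⟩ := exists_rungQuot_eq (a := a) hp hj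
  obtain ⟨A, hA⟩ := X_sub_C_dvd_rung (a := a) (p := p) (s := s) (j + 1)
  refine ⟨A * rung a p s (j + 1) ^ (p - 2), rung a p s (j + 1) * g +
    C ((a ^ p ^ (s - (j + 1))) ^ (p - 1)), ?_⟩
  rw [hg, show p - 1 = p - 2 + 1 by have := hp.two_le; omega]
  linear_combination (rung a p s (j + 1) ^ (p - 2)) * hA

/-- Unless `p = 2` and `j + 1 = k = r`, the error term in the product lies in `(X - a, p)`. -/
theorem error_eq_add (hp : p.Prime) {r : ℕ} {u : ℤ} {j k : ℕ} (hjk : j + 1 ≤ k) (hk : k ≤ s)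
    (hex : p ≠ 2 ∨ j + 1 < k ∨ k < r) : ∃ W A B : ℤ[X],
    rung a p s (j + 1) = rung a p s k * W ∧
    rung a p s (j + 1) ^ (p - 2) * W * C ((p : ℤ) ^ (r - k) * u) = (X - C a) * A + C (p : ℤ) * B := by
  obtain ⟨W, hW⟩ := rung_dvd_rung (a := a) (p := p) hjk hk
  rcases hex with h | h | h
  · obtain ⟨A, hA⟩ := X_sub_C_dvd_rung (a := a) (p := p) (s := s) (j + 1)
    refine ⟨W, A * rung a p s (j + 1) ^ (p - 3) * W * C ((p : ℤ) ^ (r - k) * u), 0, hW, ?_⟩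
    rw [show p - 2 = p - 3 + 1 by have := hp.two_le; omega]
    linear_combination (rung a p s (j + 1) ^ (p - 3) * W * C ((p : ℤ) ^ (r - k) * u)) * hA
  · obtain ⟨W', hW'⟩ := rung_dvd_rung (a := a) (p := p) (show j + 2 ≤ k by omega) hk
    obtain ⟨A, B, hAB⟩ := rungQuot_eq_add (a := a) hp (show j + 1 < s by omega)
    have h2 := rung_mul_rungQuot (a := a) (p := p) (show j + 1 < s by omega)
    refine ⟨W' * rungQuot a p s (j + 2),
      A * rung a p s (j + 1) ^ (p - 2) * W' * C ((p : ℤ) ^ (r - k) * u),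
      B * rung a p s (j + 1) ^ (p - 2) * W' * C ((p : ℤ) ^ (r - k) * u), ?_, ?_⟩
    · rw [← h2, hW']; ring
    · linear_combination (rung a p s (j + 1) ^ (p - 2) * W' * C ((p : ℤ) ^ (r - k) * u)) * hAB
  · refine ⟨W, 0, rung a p s (j + 1) ^ (p - 2) * W * C ((p : ℤ) ^ (r - k - 1) * u), hW, ?_⟩
    rw [show r - k = r - k - 1 + 1 by omega]
    simp only [pow_succ, C_mul, add_tsub_cancel_right]
    ring
end

/-! ### The order generated by the elements `quotElt` and its triangular basis -/

/-- The subring of `K` generated by `θ` and the elements `quotElt j` with `j ≤ m`. -/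
noncomputable def quotAlg {K : Type*} [Field K] (a : ℤ) (p s : ℕ) (θ : K) (m : ℕ) :
    Subalgebra ℤ K :=
  Algebra.adjoin ℤ (insert θ (quotElt a p s θ '' Set.Iic m))

/-- The `ℤ[θ]`-submodule of `K` generated by the elements `quotElt j` with `j ≤ m`, as an
additive group. -/
noncomputable def quotSpan {K : Type*} [Field K] (a : ℤ) (p s : ℕ) (θ : K) (m : ℕ) :
    Submodule ℤ K :=
  Submodule.span ℤ {x | ∃ (q : ℤ[X]) (j : ℕ), j ≤ m ∧ x = aeval θ q * quotElt a p s θ j}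

/-- The largest `t ≤ m` such that `rungProd t`, of degree `p ^ s - p ^ (s - t)`, has degree
at most `i`. -/
def blockIdx (p s m i : ℕ) : ℕ := Nat.findGreatest (fun t => p ^ s - p ^ (s - t) ≤ i) m

/-- The triangular basis: a monic integral polynomial of degree `i` in `θ`, divided
by `p ^ blockIdx i`. -/
noncomputable def quotBasis {K : Type*} [Field K] (a : ℤ) (p s : ℕ) (θ : K) (m i : ℕ) : K :=
  θ ^ (i - (p ^ s - p ^ (s - blockIdx p s m i))) * quotElt a p s θ (blockIdx p s m i)

section
variable {K : Type*} [Field K] {a : ℤ} {p s m : ℕ} {θ : K}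

theorem self_mem_quotAlg : θ ∈ quotAlg a p s θ m :=
  Algebra.subset_adjoin (Set.mem_insert _ _)

theorem aeval_mem_quotAlg (q : ℤ[X]) : aeval θ q ∈ quotAlg a p s θ m :=
  by
  have h : Algebra.adjoin ℤ {θ} ≤ quotAlg a p s θ m :=
    Algebra.adjoin_mono (Set.singleton_subset_iff.mpr (Set.mem_insert _ _))
  exact h (aeval_mem_adjoin_singleton ℤ θ)

theorem quotElt_mem_quotAlg {j : ℕ} (hj : j ≤ m) : quotElt a p s θ j ∈ quotAlg a p s θ m :=
  Algebra.subset_adjoin (Set.mem_insert_of_mem _ ⟨j, hj, rfl⟩)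

theorem aeval_mul_quotElt_mem_quotSpan (q : ℤ[X]) {j : ℕ} (hj : j ≤ m) :
    aeval θ q * quotElt a p s θ j ∈ quotSpan a p s θ m :=
  Submodule.subset_span ⟨q, j, hj, rfl⟩

theorem aeval_mul_mem_quotSpan (q : ℤ[X]) {x : K} (hx : x ∈ quotSpan a p s θ m) :
    aeval θ q * x ∈ quotSpan a p s θ m := by
  induction hx using Submodule.span_induction with
  | mem x hx =>
    obtain ⟨q', j, hj, rfl⟩ := hx
    rw [← mul_assoc, ← map_mul]
    exact aeval_mul_quotElt_mem_quotSpan _ hj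
  | zero => simp
  | add x y _ _ hx hy => rw [mul_add]; exact add_mem hx hy
  | smul n x _ hx => rw [mul_smul_comm]; exact Submodule.smul_mem _ _ hx

theorem quotElt_mul_quotElt_mem_quotSpan [CharZero K] (hp : p.Prime) (hθ : θ ^ p ^ s = (a : K)) {r : ℕ} {u : ℤ}
    (hu : a - a ^ p ^ s = p ^ (r + 1) * u) (hms : m ≤ s) (hmr : m ≤ r) {j k : ℕ} (hjk : j ≤ k)
    (hk : k ≤ m) : quotElt a p s θ j * quotElt a p s θ k ∈ quotSpan a p s θ m := by
  induction j with
  | zero =>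
    rw [quotElt_zero, ← map_one (aeval (R := ℤ) θ)]
    exact aeval_mul_quotElt_mem_quotSpan 1 hk
  | succ j ih =>
    obtain ⟨W, hW⟩ := rung_dvd_rung (a := a) (p := p) hjk (hk.trans hms)
    obtain ⟨G, hG⟩ := quotElt_succ_mul_quotElt hp hθ hu hjk (hk.trans hms) (hk.trans hmr) hW
    rw [hG]
    refine add_mem ?_ ?_
    · have := (quotSpan a p s θ m).smul_mem (a ^ (p ^ (s - (j + 1)) * (p - 1))) (ih (by omega))
      simpa using this
    · rw [mul_comm]
      exact aeval_mul_quotElt_mem_quotSpan _ (by omega)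

theorem quotAlg_le_quotSpan [CharZero K] (hp : p.Prime) (hθ : θ ^ p ^ s = (a : K)) {r : ℕ} {u : ℤ}
    (hu : m ≠ 0 → a - a ^ p ^ s = p ^ (r + 1) * u) (hms : m ≤ s) (hmr : m ≤ r) :
    ∀ x ∈ quotAlg a p s θ m, x ∈ quotSpan a p s θ m := by
  have key : ∀ x ∈ quotAlg a p s θ m, ∀ y ∈ quotSpan a p s θ m, x * y ∈ quotSpan a p s θ m := by
    intro x hx
    induction hx using Algebra.adjoin_induction with
    | mem x hx =>
      intro y hy
      rcases hx with rfl | ⟨j, hj, rfl⟩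
      · simpa using aeval_mul_mem_quotSpan X hy
      · rcases Nat.eq_zero_or_pos m with hm | hm
        · obtain rfl : j = 0 := by have := Set.mem_Iic.mp hj; omega
          rwa [quotElt_zero, one_mul]
        induction hy using Submodule.span_induction with
        | mem y hy =>
          obtain ⟨q, k, hk, rfl⟩ := hy
          rw [mul_left_comm]
          apply aeval_mul_mem_quotSpan
          rcases le_total j k with h | h
          · exact quotElt_mul_quotElt_mem_quotSpan hp hθ (hu hm.ne') hms hmr h hk
          · rw [mul_comm]
            exact quotElt_mul_quotElt_mem_quotSpan hp hθ (hu hm.ne') hms hmr h hj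
        | zero => simp
        | add x y _ _ hx hy => rw [mul_add]; exact add_mem hx hy
        | smul n x _ hx => rw [mul_smul_comm]; exact Submodule.smul_mem _ _ hx
    | algebraMap n =>
      intro y hy
      have := (quotSpan a p s θ m).smul_mem n hy
      simpa using this
    | add x x' _ _ hx hx' => intro y hy; rw [add_mul]; exact add_mem (hx y hy) (hx' y hy)
    | mul x x' _ _ hx hx' => intro y hy; rw [mul_assoc]; exact hx _ (hx' y hy)
  intro x hx
  have h1 : (1 : K) ∈ quotSpan a p s θ m := by
    have := aeval_mul_quotElt_mem_quotSpan (a := a) (p := p) (s := s) (θ := θ) 1 (Nat.zero_le m)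
    rwa [quotElt_zero, map_one, one_mul] at this
  simpa using key x hx 1 h1

theorem pow_sub_pow_mono (hp : 0 < p) {i j : ℕ} (h : i ≤ j) :
    p ^ s - p ^ (s - i) ≤ p ^ s - p ^ (s - j) := by
  have := Nat.pow_le_pow_right hp (show s - j ≤ s - i by omega)
  omega

theorem le_blockIdx_iff (hp : 0 < p) {i t : ℕ} :
    t ≤ blockIdx p s m i ↔ t ≤ m ∧ p ^ s - p ^ (s - t) ≤ i := by
  constructor
  · intro h
    refine ⟨h.trans (Nat.findGreatest_le m), (pow_sub_pow_mono hp h).trans ?_⟩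
    exact Nat.findGreatest_spec (P := fun t => p ^ s - p ^ (s - t) ≤ i) (Nat.zero_le m) (by simp)
  · rintro ⟨h1, h2⟩
    exact Nat.le_findGreatest h1 h2

theorem quotElt_mem_span_quotBasis (hp : 0 < p) {i j : ℕ} (hj : j ≤ m) (hms : m ≤ s)
    (hi : i < p ^ (s - j))
    (hi' : j < m → i < p ^ (s - j) - p ^ (s - (j + 1))) :
    θ ^ i * quotElt a p s θ j ∈
      Submodule.span ℤ (Set.range fun i : Fin (p ^ s) => quotBasis a p s θ m i) := by
  have h1 : p ^ (s - j) ≤ p ^ s := Nat.pow_le_pow_right hp (by omega)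
  have hb : blockIdx p s m (p ^ s - p ^ (s - j) + i) = j := by
    apply le_antisymm
    · by_contra! h
      have h2 := (le_blockIdx_iff hp).mp (Nat.succ_le_of_lt h)
      have h3 := hi' (by omega)
      have := h2.2
      simp only [Nat.succ_eq_add_one] at this
      omega
    · exact (le_blockIdx_iff hp).mpr ⟨hj, by omega⟩
  refine Submodule.subset_span ⟨⟨p ^ s - p ^ (s - j) + i, by omega⟩, ?_⟩
  simp only [quotBasis, hb]
  rw [show p ^ s - p ^ (s - j) + i - (p ^ s - p ^ (s - j)) = i by omega]

/-- Division of `q` by `rungQuot (j + 1)` leaves a remainder covered by the `j`-th block of the basis,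
and `rungQuot (j + 1) * quotElt j = p * quotElt (j + 1)` passes the quotient on to the next block. -/
theorem aeval_mul_quotElt_mem_span_of_natDegree_lt [CharZero K] (hp : p.Prime) (hms : m ≤ s) {j : ℕ}
    (hj : j ≤ m) (q : ℤ[X]) (hq : q.natDegree < p ^ (s - j)) :
    aeval θ q * quotElt a p s θ j ∈
      Submodule.span ℤ (Set.range fun i : Fin (p ^ s) => quotBasis a p s θ m i) := by
  have hsum : ∀ j ≤ m, ∀ (N : ℕ) (q : ℤ[X]), q.natDegree < N → N ≤ p ^ (s - j) →
      (j < m → N ≤ p ^ (s - j) - p ^ (s - (j + 1))) →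
      aeval θ q * quotElt a p s θ j ∈
        Submodule.span ℤ (Set.range fun i : Fin (p ^ s) => quotBasis a p s θ m i) := by
    intro j hj N q hq hN hN'
    rw [aeval_eq_sum_range' hq, Finset.sum_mul]
    refine Submodule.sum_mem _ fun i hi => ?_
    rw [smul_mul_assoc]
    have hi := Finset.mem_range.mp hi
    exact Submodule.smul_mem _ _ (quotElt_mem_span_quotBasis hp.pos hj hms (by omega)
      fun h => by have := hN' h; omega)
  induction hd : m - j generalizing j q with
  | zero => exact hsum j hj _ q hq le_rfl (by omega)
  | succ d ih =>
    have hjs : j < s := by omega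
    have hm := rungQuot_monic (a := a) hp.pos hjs
    have hdeg := natDegree_rungQuot (a := a) hp.pos hjs
    have hlt : p ^ (s - (j + 1)) < p ^ (s - j) := Nat.pow_lt_pow_right hp.one_lt (by omega)
    have hpos : 0 < p ^ (s - (j + 1)) := pow_pos hp.pos _
    rw [← modByMonic_add_div q (rungQuot a p s (j + 1)), map_add, add_mul]
    refine add_mem (hsum j hj _ _ (natDegree_modByMonic_lt _ hm ?_) (by omega) (by omega)) ?_
    · intro h
      rw [h, natDegree_one] at hdeg
      omega
    · have h1 : aeval θ (rungQuot a p s (j + 1) * (q /ₘ rungQuot a p s (j + 1))) *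
          quotElt a p s θ j = (p : ℤ) • (aeval θ (q /ₘ rungQuot a p s (j + 1)) *
            quotElt a p s θ (j + 1)) := by
        have := p_mul_quotElt_succ (a := a) (s := s) (θ := θ) hp.ne_zero j
        rw [zsmul_eq_mul, Int.cast_natCast, mul_left_comm, this, map_mul]
        ring
      rw [h1]
      refine Submodule.smul_mem _ _ (ih (by omega) _ ?_ (by omega))
      rw [natDegree_divByMonic _ hm]; omega

theorem quotSpan_le_span_quotBasis [CharZero K] (hp : p.Prime) (hθ : θ ^ p ^ s = (a : K)) {r : ℕ} {u : ℤ}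
    (hu : m ≠ 0 → a - a ^ p ^ s = p ^ (r + 1) * u) (hms : m ≤ s) (hmr : m ≤ r) :
    quotSpan a p s θ m ≤
      Submodule.span ℤ (Set.range fun i : Fin (p ^ s) => quotBasis a p s θ m i) := by
  have h0 : ∀ q : ℤ[X], aeval θ q ∈
      Submodule.span ℤ (Set.range fun i : Fin (p ^ s) => quotBasis a p s θ m i) := by
    intro q
    have hm : (X ^ p ^ s - C a : ℤ[X]).Monic := monic_X_pow_sub_C _ (pow_pos hp.pos _).ne'
    rw [← modByMonic_add_div q (X ^ p ^ s - C a), map_add, map_mul]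
    have h1 : aeval θ (X ^ p ^ s - C a : ℤ[X]) = 0 := by simp [hθ]
    rw [h1, zero_mul, add_zero]
    have := aeval_mul_quotElt_mem_span_of_natDegree_lt (a := a) (θ := θ) hp hms (Nat.zero_le m)
      (q %ₘ (X ^ p ^ s - C a)) ?_
    · rwa [quotElt_zero, mul_one] at this
    · have := natDegree_modByMonic_lt q hm ?_
      · rwa [natDegree_X_pow_sub_C] at this
      · intro h
        have := congrArg natDegree h
        rw [natDegree_X_pow_sub_C, natDegree_one] at this
        exact (pow_pos hp.pos _).ne' this
  rw [quotSpan, Submodule.span_le]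
  rintro _ ⟨q, j, hj, rfl⟩
  rcases Nat.eq_zero_or_pos j with rfl | hj0
  · rw [quotElt_zero, mul_one]; exact h0 q
  have hm := rung_monic (a := a) (s := s) hp.pos j
  rw [SetLike.mem_coe, ← modByMonic_add_div q (rung a p s j), map_add, add_mul]
  refine add_mem (aeval_mul_quotElt_mem_span_of_natDegree_lt hp hms hj _ ?_) ?_
  · rw [← natDegree_rung (a := a) j]
    refine natDegree_modByMonic_lt q hm fun h => ?_
    have := congrArg natDegree h
    rw [natDegree_rung, natDegree_one] at this
    exact (pow_pos hp.pos _).ne' this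
  · have h1 := rung_mul_quotElt hp.ne_zero hθ (hu (by omega)) (hj.trans hms) (show j ≤ r + 1 by omega)
    have h2 : aeval θ (rung a p s j * (q /ₘ rung a p s j)) * quotElt a p s θ j =
        aeval θ (C ((p : ℤ) ^ (r + 1 - j) * u) * (q /ₘ rung a p s j)) := by
      rw [map_mul, map_mul, mul_right_comm, h1]
      simp
    rw [h2]
    exact h0 _
end

/-! ### Maximality at `p` -/

/-- The ideal of `quotAlg` generated by `θ - a` and `p`, as a submodule of `K`, so that membership can
be stated for elements of `K`. -/
noncomputable def rootIdeal {K : Type*} [Field K] (a : ℤ) (p s : ℕ) (θ : K) (m : ℕ) :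
    Submodule (quotAlg a p s θ m) K :=
  Submodule.span _ {θ - a, (p : K)}

/-- The elements of `O` that multiply `x` into `O`. -/
def denomIdeal {K : Type*} [Field K] (O : Subalgebra ℤ K) (x : K) : Ideal O where
  carrier := {w | (w : K) * x ∈ O}
  zero_mem' := by simp
  add_mem' {v w} hv hw := by
    simpa [add_mul] using O.add_mem hv hw
  smul_mem' c w hw := by
    simpa [mul_assoc] using O.mul_mem c.2 hw

section
variable {K : Type*} [Field K] {a : ℤ} {p s m : ℕ} {θ : K}

theorem mul_mem_rootIdeal {w x : K} (hw : w ∈ quotAlg a p s θ m) (hx : x ∈ rootIdeal a p s θ m) :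
    w * x ∈ rootIdeal a p s θ m :=
  (rootIdeal a p s θ m).smul_mem ⟨w, hw⟩ hx

theorem sub_mul_mem_rootIdeal {w : K} (hw : w ∈ quotAlg a p s θ m) :
    (θ - a) * w ∈ rootIdeal a p s θ m := by
  rw [mul_comm]
  exact mul_mem_rootIdeal hw (Submodule.subset_span (by simp))

theorem p_mul_mem_rootIdeal {w : K} (hw : w ∈ quotAlg a p s θ m) :
    p * w ∈ rootIdeal a p s θ m := by
  rw [mul_comm]
  exact mul_mem_rootIdeal hw (Submodule.subset_span (by simp))

theorem intCast_mul_mem_rootIdeal {n : ℤ} (hn : (p : ℤ) ∣ n) {w : K}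
    (hw : w ∈ quotAlg a p s θ m) : n * w ∈ rootIdeal a p s θ m := by
  obtain ⟨c, rfl⟩ := hn
  have := p_mul_mem_rootIdeal ((quotAlg a p s θ m).mul_mem ((quotAlg a p s θ m).intCast_mem c) hw)
  push_cast
  rwa [mul_assoc]

theorem aeval_mem_rootIdeal (A B : ℤ[X]) :
    aeval θ ((X - C a) * A + C (p : ℤ) * B) ∈ rootIdeal a p s θ m := by
  have h1 := sub_mul_mem_rootIdeal (aeval_mem_quotAlg (a := a) (p := p) (s := s) (m := m) (θ := θ) A)
  have h2 := p_mul_mem_rootIdeal (aeval_mem_quotAlg (a := a) (p := p) (s := s) (m := m) (θ := θ) B)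
  simpa using add_mem h1 h2

theorem dvd_pow_sub_one (hp : p.Prime) (hpa : ¬ (p : ℤ) ∣ a) (t : ℕ) :
    (p : ℤ) ∣ a ^ (t * (p - 1)) - 1 := by
  have h : IsCoprime (a ^ t) (p : ℤ) :=
    (((Nat.prime_iff_prime_int.mp hp).irreducible.coprime_iff_not_dvd.mpr hpa).symm).pow_left
  have := Int.ModEq.pow_card_sub_one_eq_one hp h
  rw [pow_mul]
  exact this.symm.dvd

/-- Modulo `(θ - a, p)` the elements `quotElt j` form a decreasing chain of idempotents, with the
possible exception of the last one when `p = 2`. -/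
theorem quotElt_mul_quotElt_sub_mem [CharZero K] (hp : p.Prime) (hpa : ¬ (p : ℤ) ∣ a)
    (hθ : θ ^ p ^ s = (a : K)) {r : ℕ} {u : ℤ}
    (hu : a - a ^ p ^ s = p ^ (r + 1) * u) (hms : m ≤ s) (hmr : m ≤ r) {j k : ℕ} (hjk : j ≤ k)
    (hk : k ≤ m) (hex : p ≠ 2 ∨ j < k ∨ k < r) :
    quotElt a p s θ j * quotElt a p s θ k - quotElt a p s θ k ∈ rootIdeal a p s θ m := by
  induction j with
  | zero => rw [quotElt_zero, one_mul, sub_self]; exact zero_mem _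
  | succ j ih =>
    obtain ⟨W, A, B, hW, hAB⟩ := error_eq_add (a := a) (u := u) hp hjk (hk.trans hms) hex
    obtain ⟨G, hG⟩ := quotElt_succ_mul_quotElt hp hθ hu hjk (hk.trans hms) (hk.trans hmr) hW
    have h1 := ih (by omega) (Or.inr (Or.inl (by omega)))
    have hj := quotElt_mem_quotAlg (a := a) (p := p) (s := s) (θ := θ) (show j ≤ m by omega)
    have hk' := quotElt_mem_quotAlg (a := a) (p := p) (s := s) (θ := θ) hk
    rw [hAB, add_assoc, ← mul_add] at hG
    have h2 := mul_mem_rootIdeal hj (aeval_mem_rootIdeal (a := a) (p := p) (s := s) (m := m) (θ := θ) A (B + G))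
    have h3 := intCast_mul_mem_rootIdeal (dvd_pow_sub_one hp hpa (p ^ (s - (j + 1))))
      ((quotAlg a p s θ m).mul_mem hj hk')
    have h4 := add_mem (add_mem h1 h2) h3
    convert h4 using 1
    rw [hG]
    push_cast
    ring

theorem pow_sub_self_mem_rootIdeal {z : K} (hz : z ∈ quotAlg a p s θ m)
    (h : z * z - z ∈ rootIdeal a p s θ m) (n : ℕ) : z ^ (n + 1) - z ∈ rootIdeal a p s θ m := by
  induction n with
  | zero => simp
  | succ n ih =>
    have := add_mem (mul_mem_rootIdeal hz ih) h
    convert this using 1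
    ring

theorem quotElt_pow_sub_self_mem [CharZero K] (hp : p.Prime) (hpa : ¬ (p : ℤ) ∣ a)
    (hθ : θ ^ p ^ s = (a : K)) {r : ℕ} {u : ℤ}
    (hu : a - a ^ p ^ s = p ^ (r + 1) * u) (hpu : ¬ (p : ℤ) ∣ u) (hms : m ≤ s) (hmr : m ≤ r)
    {j : ℕ} (hj : j ≤ m) :
    quotElt a p s θ j ^ p ^ 2 - quotElt a p s θ j ∈ rootIdeal a p s θ m := by
  have hjO := quotElt_mem_quotAlg (a := a) (p := p) (s := s) (θ := θ) hj
  have hpos : p ^ 2 = p ^ 2 - 1 + 1 := (Nat.sub_add_cancel (pow_pos hp.pos 2)).symm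
  by_cases hex : p ≠ 2 ∨ j < r
  · rw [hpos]
    exact pow_sub_self_mem_rootIdeal hjO (quotElt_mul_quotElt_sub_mem hp hpa hθ hu hms hmr le_rfl hj
      (hex.imp_right Or.inr)) _
  · push Not at hex
    obtain ⟨rfl, hr⟩ := hex
    rcases j with _ | j
    · rw [quotElt_zero]; simp
    obtain rfl : r = j + 1 := by omega
    -- here the residue ring acquires a factor with four elements: `x ^ 2 = x + y` modulo the ideal
    obtain ⟨G, hG⟩ := quotElt_succ_mul_quotElt (W := 1) hp hθ hu le_rfl (hj.trans hms) le_rfl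
      (by rw [mul_one])
    have hyO := quotElt_mem_quotAlg (a := a) (p := 2) (s := s) (θ := θ) (show j ≤ m by omega)
    have hyy := quotElt_mul_quotElt_sub_mem hp hpa hθ hu hms hmr (le_refl j) (by omega)
      (Or.inr (Or.inr (by omega)))
    have hyx := quotElt_mul_quotElt_sub_mem hp hpa hθ hu hms hmr (Nat.le_succ j) hj
      (Or.inr (Or.inl (by omega)))
    set x := quotElt a 2 s θ (j + 1)
    set y := quotElt a 2 s θ j
    have h3 := intCast_mul_mem_rootIdeal (dvd_pow_sub_one hp hpa (2 ^ (s - (j + 1))))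
      ((quotAlg a 2 s θ m).mul_mem hyO hjO)
    have h4 : ((2 : ℕ) : ℤ) ∣ u - 1 := by omega
    have h5 := intCast_mul_mem_rootIdeal h4 hyO
    have h6 := mul_mem_rootIdeal hyO
      (p_mul_mem_rootIdeal (aeval_mem_quotAlg (a := a) (p := 2) (s := s) (m := m) (θ := θ) G))
    have hxx : x * x - x - y ∈ rootIdeal a 2 s θ m := by
      have h7 := add_mem (add_mem (add_mem h3 h5) h6) hyx
      convert h7 using 1
      have e2 : aeval θ (2 : ℤ[X]) = 2 := map_ofNat _ 2
      rw [hG]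
      simp [e2]
      ring
    have h8 := mul_mem_rootIdeal ((quotAlg a 2 s θ m).add_mem
      ((quotAlg a 2 s θ m).add_mem ((quotAlg a 2 s θ m).mul_mem hjO hjO) hjO) hyO) hxx
    have h9 := p_mul_mem_rootIdeal ((quotAlg a 2 s θ m).add_mem hyO
      ((quotAlg a 2 s θ m).mul_mem hjO hyO))
    have h10 := add_mem (add_mem (add_mem h8 hxx) hyy) h9
    convert h10 using 1
    push_cast
    ring

theorem comap_rootIdeal_isRadical [CharZero K] (hp : p.Prime) (hpa : ¬ (p : ℤ) ∣ a)
    (hθ : θ ^ p ^ s = (a : K)) {r : ℕ} {u : ℤ}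
    (hu : a - a ^ p ^ s = p ^ (r + 1) * u) (hpu : ¬ (p : ℤ) ∣ u) (hms : m ≤ s) (hmr : m ≤ r) :
    Ideal.IsRadical ((rootIdeal a p s θ m).comap (Algebra.linearMap (quotAlg a p s θ m) K)) := by
  refine isRadical_of_pow_sub_self_mem _ (N := p ^ 2) (hp.two_le.trans (Nat.le_self_pow two_ne_zero p)) ?_
  refine pow_sub_self_mem_of_adjoin_eq_top _ hp 2 ?_ _ Algebra.adjoin_adjoin_coe_preimage ?_
  · have := p_mul_mem_rootIdeal (quotAlg a p s θ m).one_mem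
    simpa using this
  · rintro ⟨x, hxO⟩ hx
    have hx : x ∈ insert θ (quotElt a p s θ '' Set.Iic m) := hx
    show x ^ p ^ 2 - x ∈ rootIdeal a p s θ m
    rcases hx with rfl | ⟨j, hj, rfl⟩
    · obtain ⟨q, hq⟩ := sub_dvd_pow_sub_pow (X : ℤ[X]) (C a) (p ^ 2)
      obtain ⟨c, hc⟩ : (p : ℤ) ∣ a ^ p ^ 2 - a := by
        have := Fact.mk hp
        rw [← ZMod.intCast_zmod_eq_zero_iff_dvd]
        push_cast
        rw [ZMod.pow_card_pow, sub_self]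
      have := aeval_mem_rootIdeal (a := a) (p := p) (s := s) (m := m) (θ := x) (q - 1) (C c)
      convert this using 1
      rw [mul_sub, ← hq, ← C_mul, ← hc]
      simp
      ring
    · exact quotElt_pow_sub_self_mem hp hpa hθ hu hpu hms hmr hj

theorem isIntegral_of_mem_quotAlg [CharZero K] (hp : p.Prime) (hθ : θ ^ p ^ s = (a : K)) {r : ℕ}
    {u : ℤ} (hu : m ≠ 0 → a - a ^ p ^ s = p ^ (r + 1) * u) (hms : m ≤ s) (hmr : m ≤ r) {x : K}
    (hx : x ∈ quotAlg a p s θ m) : IsIntegral ℤ x := by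
  refine IsIntegral.of_mem_of_fg (quotAlg a p s θ m) ?_ x hx
  have := isNoetherian_span_of_finite ℤ
    (Set.finite_range fun i : Fin (p ^ s) => quotBasis a p s θ m i)
  exact isNoetherian_submodule.mp this _ fun y hy =>
    quotSpan_le_span_quotBasis hp hθ hu hms hmr (quotAlg_le_quotSpan hp hθ hu hms hmr y hy)

/-- Each `p * quotElt j` is congruent modulo `θ - a` to `p` times an integer prime to `p`; this
makes up for `θ - a` not being a uniformizer when `r > s`. -/
theorem exists_p_mul_quotElt_sub [CharZero K] (hp : p.Prime) (hpa : ¬ (p : ℤ) ∣ a) {j : ℕ}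
    (hj : j ≤ m) (hms : m ≤ s) : ∃ c : ℤ, ¬ (p : ℤ) ∣ c ∧ ∃ w ∈ quotAlg a p s θ m,
      (p : K) * (quotElt a p s θ j - c) = (θ - a) * w := by
  have hpi := Nat.prime_iff_prime_int.mp hp
  induction j with
  | zero => exact ⟨1, hpi.not_dvd_one, 0, zero_mem _, by simp [quotElt_zero]⟩
  | succ j ih =>
    obtain ⟨c, hc, w, hw, h⟩ := ih (by omega)
    obtain ⟨g, hg⟩ := exists_rungQuot_eq (a := a) hp (show j < s by omega)
    obtain ⟨A, hA⟩ := X_sub_C_dvd_rung (a := a) (p := p) (s := s) (j + 1)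
    refine ⟨c * (a ^ p ^ (s - (j + 1))) ^ (p - 1), ?_, quotElt a p s θ j *
      aeval θ (A * rung a p s (j + 1) ^ (p - 2) + C (p : ℤ) * (A * g)) +
      (a ^ p ^ (s - (j + 1))) ^ (p - 1) * w, ?_, ?_⟩
    · exact hpi.not_dvd_mul hc fun h => hpa (hpi.dvd_of_dvd_pow (hpi.dvd_of_dvd_pow h))
    · refine add_mem (mul_mem (quotElt_mem_quotAlg (by omega)) (aeval_mem_quotAlg _))
        (mul_mem (pow_mem (pow_mem (intCast_mem _ a) _) _) hw)
    · have hA' := congrArg (aeval θ) hA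
      rw [mul_sub, p_mul_quotElt_succ hp.ne_zero, hg,
        show p - 1 = p - 2 + 1 by have := hp.two_le; omega]
      simp only [eq_intCast, map_add, map_mul, map_pow, map_intCast, map_sub, aeval_X,
        map_natCast, Int.cast_pow, Int.cast_mul] at hA' ⊢
      linear_combination ((a : K) ^ p ^ (s - (j + 1))) ^ (p - 2 + 1) * h +
        quotElt a p s θ j * (aeval θ (rung a p s (j + 1)) ^ (p - 2) + p * aeval θ g) * hA'

/-- The order `quotAlg` is maximal at `p`. -/
theorem mem_quotAlg_of_isIntegral [CharZero K] (hp : p.Prime) (hpa : ¬ (p : ℤ) ∣ a)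
    (hθ : θ ^ p ^ s = (a : K)) (hθa : θ ≠ a) {r : ℕ} {u : ℤ}
    (hu : a - a ^ p ^ s = p ^ (r + 1) * u) (hpu : ¬ (p : ℤ) ∣ u) {x : K} (hx : IsIntegral ℤ x)
    {A : ℕ} (hA : (p : K) ^ A * x ∈ quotAlg a p s θ (min r s)) : x ∈ quotAlg a p s θ (min r s) := by
  have hms : min r s ≤ s := min_le_right _ _
  have hmr : min r s ≤ r := min_le_left _ _
  have hint : ∀ z : quotAlg a p s θ (min r s), IsIntegral ℤ (z : K) := fun z =>
    isIntegral_of_mem_quotAlg hp hθ (fun _ => hu) hms hmr z.2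
  have hrad := comap_rootIdeal_isRadical (m := min r s) hp hpa hθ hu hpu hms hmr
  set O := quotAlg a p s θ (min r s) with hO
  have hI : ∀ z : O, (z : K) ∈ rootIdeal a p s θ (min r s) →
      ∃ α β : O, (z : K) = α * (θ - a) + β * p := by
    intro z hz
    obtain ⟨α, β, h⟩ := Submodule.mem_span_pair.mp hz
    exact ⟨α, β, h.symm⟩
  set y : O := ⟨θ - a, sub_mem self_mem_quotAlg (intCast_mem _ a)⟩ with hy
  have hy0 : y ≠ 0 := fun h => hθa (sub_eq_zero.mp (congrArg Subtype.val h))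
  have hp0 : (p : O) ≠ 0 := by exact_mod_cast hp.ne_zero
  have hpK : (p : K) ≠ 0 := by exact_mod_cast hp.ne_zero
  -- a power of `θ - a` is divisible by `p`, by Frobenius
  obtain ⟨N, hN⟩ : ∃ N, (y : K) ^ N * x ∈ O := by
    set t : O := ⟨θ, self_mem_quotAlg⟩ with ht
    obtain ⟨R, hR⟩ := exists_add_pow_prime_pow_eq hp t (-(a : O)) s
    obtain ⟨c, hc⟩ : (p : ℤ) ∣ a + (-a) ^ p ^ s := by
      have := Fact.mk hp
      rw [← ZMod.intCast_zmod_eq_zero_iff_dvd]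
      push_cast
      rw [ZMod.pow_card_pow, add_neg_cancel]
    have h1 : (y : K) ^ p ^ s = p * ((c : O) + t * (-(a : O)) * R : O) := by
      have h2 := congrArg Subtype.val hR
      have h3 := congrArg (Int.cast : ℤ → K) hc
      push_cast at h2 h3
      simp only [hy, ht] at h2 ⊢
      push_cast
      rw [sub_eq_add_neg, h2, hθ]
      linear_combination h3
    refine ⟨p ^ s * A, ?_⟩
    rw [pow_mul, h1, mul_pow, mul_comm ((p : K) ^ A), mul_assoc]
    exact mul_mem (pow_mem (Subtype.prop _) _) hA
  have hyI : y ∈ (rootIdeal a p s θ (min r s)).comap (Algebra.linearMap O K) :=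
    Submodule.subset_span (by simp [hy])
  have hpI : (p : O) ∈ (rootIdeal a p s θ (min r s)).comap (Algebra.linearMap O K) :=
    Submodule.subset_span (by simp)
  -- it suffices that no maximal ideal contains all `w` with `w * x ∈ O`
  suffices h : denomIdeal O x = ⊤ by
    have h1 : (1 : O) ∈ denomIdeal O x := h ▸ Submodule.mem_top
    simpa using (show ((1 : O) : K) * x ∈ O from h1)
  by_contra hne
  obtain ⟨P, hP, hle⟩ := Ideal.exists_le_maximal _ hne
  have hPp := hP.isPrime
  have hpP : (p : O) ∈ P := hPp.mem_of_pow_mem A (hle (show (((p : O) ^ A : O) : K) * x ∈ O by simpa using hA))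
  have hcop : ∀ c : ℤ, ¬ (p : ℤ) ∣ c → (c : O) ∉ P := by
    intro c hc hcP
    obtain ⟨b, d, hbd⟩ := (Nat.prime_iff_prime_int.mp hp).irreducible.coprime_iff_not_dvd.mpr hc
    apply hPp.ne_top
    rw [Ideal.eq_top_iff_one]
    have := congrArg (Int.cast : ℤ → O) hbd
    push_cast at this
    rw [← this]
    exact add_mem (P.mul_mem_left _ hpP) (P.mul_mem_left _ hcP)
  rcases le_total r s with hrs | hrs
  · have hm : min r s = r := min_eq_left hrs
    have h1 := rung_mul_quotElt hp.ne_zero hθ hu hrs (Nat.le_succ r)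
    obtain ⟨B, hB⟩ := X_sub_C_dvd_rung (a := a) (p := p) (s := s) r
    have h2 := pow_mul_mem_of_isRadical O _ hrad y (u : O) hyI hy0 ?_ N x hx hint hN
    · exact hcop u hpu (hPp.mem_of_pow_mem N (hle (show (((u : O) ^ N : O) : K) * x ∈ O by simpa using h2)))
    · intro z hz
      obtain ⟨α, β, hz⟩ := hI z hz
      refine ⟨α * u + β * ⟨aeval θ B * quotElt a p s θ r, mul_mem (aeval_mem_quotAlg B)
        (quotElt_mem_quotAlg hm.ge)⟩, Subtype.ext ?_⟩
      push_cast
      rw [hz]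
      simp only [hy]
      rw [hB, Nat.add_sub_cancel_left, pow_one] at h1
      simp at h1
      linear_combination -(β : K) * h1
  · have hm : min r s = s := min_eq_right hrs
    have h1 := rung_mul_quotElt hp.ne_zero hθ hu (le_refl s) (show s ≤ r + 1 by omega)
    obtain ⟨c, hc, w, hw, hcw⟩ := exists_p_mul_quotElt_sub (θ := θ) hp hpa (le_refl (min r s)) hms
    rw [← hO] at hw
    set e : O := ⟨quotElt a p s θ (min r s), quotElt_mem_quotAlg le_rfl⟩ with he
    have h2 := pow_mul_mem_of_isRadical O _ hrad y (e - (c : O)) hyI hy0 ?_ N x hx hint hN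
    have h3 := pow_mul_mem_of_isRadical O _ hrad (p : O) e hpI hp0 ?_ A x hx hint (by simpa using hA)
    · have h4 : e - (c : O) ∈ P := hPp.mem_of_pow_mem N (hle h2)
      have h5 : e ∈ P := hPp.mem_of_pow_mem A (hle h3)
      exact hcop c hc (by simpa using P.sub_mem h5 h4)
    · intro z hz
      obtain ⟨α, β, hz⟩ := hI z hz
      refine ⟨α * ((p : O) ^ (r - s) * u) + β * e, Subtype.ext ?_⟩
      push_cast
      rw [hz]
      have h6 : (θ - a) * (e : K) = p * (p ^ (r - s) * u) := by
        rw [show r + 1 - s = r - s + 1 by omega, rung] at h1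
        simp only [tsub_self, pow_zero, pow_one, map_sub, aeval_X, eq_intCast, map_intCast] at h1
        simp only [he, hm]
        rw [h1]; ring
      linear_combination (α : K) * h6
    · intro z hz
      obtain ⟨α, β, hz⟩ := hI z hz
      refine ⟨α * (e - (c : O)) + β * ⟨w, hw⟩, Subtype.ext ?_⟩
      push_cast
      rw [hz]
      simp only [hy, he]
      linear_combination (β : K) * hcw
end

/-! ### The order `ℤ[θ]` and triangular changes of basis -/

section
variable {K : Type*} [Field K] {a : ℤ} {θ : K}

theorem irreducible_X_pow_sub_C_of_squarefree {a : ℤ} (ha : Squarefree a) (hu : ¬ IsUnit a) {n : ℕ}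
    (hn : n ≠ 0) : Irreducible (X ^ n - C a : ℤ[X]) := by
  obtain ⟨q, hq, hqa⟩ := WfDvdMonoid.exists_irreducible_factor hu ha.ne_zero
  have hq := hq.prime
  have hP : (Ideal.span {q}).IsPrime := (Ideal.span_singleton_prime hq.ne_zero).mpr hq
  have hm : (X ^ n - C a : ℤ[X]).Monic := monic_X_pow_sub_C a hn
  refine irreducible_of_eisenstein_criterion hP ?_ ?_ ?_ ?_ hm.isPrimitive
  · rw [hm.leadingCoeff]
    exact fun h => hP.ne_top ((Ideal.eq_top_iff_one _).mpr h)
  · intro k hk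
    rw [degree_X_pow_sub_C (Nat.pos_of_ne_zero hn)] at hk
    have hk : k < n := by exact_mod_cast hk
    rw [coeff_sub, coeff_X_pow, if_neg hk.ne, zero_sub, coeff_C, Ideal.mem_span_singleton]
    split_ifs
    · exact hqa.neg_right
    · simp
  · rw [degree_X_pow_sub_C (Nat.pos_of_ne_zero hn)]
    exact_mod_cast Nat.pos_of_ne_zero hn
  · rw [coeff_sub, coeff_X_pow, if_neg (Ne.symm hn), zero_sub, coeff_C_zero, Ideal.span_singleton_pow,
      Ideal.mem_span_singleton, dvd_neg, sq]
    exact fun h => hq.not_isUnit (ha q h)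

theorem minpoly_eq_X_pow_sub_C [CharZero K] (ha : Squarefree a) (hu : ¬ IsUnit a) {n : ℕ}
    (hn : n ≠ 0) (hθ : θ ^ n = (a : K)) : minpoly ℚ θ = X ^ n - C (a : ℚ) := by
  have h1 := irreducible_X_pow_sub_C_of_squarefree ha hu hn
  rw [(monic_X_pow_sub_C a hn).irreducible_iff_irreducible_map_fraction_map (K := ℚ)] at h1
  have h2 : (X ^ n - C a : ℤ[X]).map (algebraMap ℤ ℚ) = X ^ n - C (a : ℚ) := by simp
  rw [h2] at h1
  exact (minpoly.eq_of_irreducible_of_monic h1 (by simp [hθ]) (monic_X_pow_sub_C _ hn)).symm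

variable [NumberField K]

theorem discr_powers_eq (ha : Squarefree a) (hu : ¬ IsUnit a) {n : ℕ} (hn : n ≠ 0)
    (hθ : θ ^ n = (a : K)) (B : PowerBasis ℚ K) (hB : B.gen = θ) :
    Algebra.discr ℚ B.basis = (-1) ^ ((n - 1) * (n - 2) / 2) * (n : ℚ) ^ n * (a : ℚ) ^ (n - 1) := by
  have hmin := minpoly_eq_X_pow_sub_C ha hu hn hθ
  have hdim : B.dim = n := by
    rw [← B.natDegree_minpoly, hB, hmin, natDegree_X_pow_sub_C]
  have hfin : Module.finrank ℚ K = n := by rw [B.finrank, hdim]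
  have hnorm : Algebra.norm ℚ θ = (-1) ^ n * (-(a : ℚ)) := by
    rw [← hB, Algebra.PowerBasis.norm_gen_eq_coeff_zero_minpoly, hdim, hB, hmin]
    simp [coeff_X_pow, hn.symm]
  have hder : aeval θ (derivative (X ^ n - C (a : ℚ))) = algebraMap ℚ K n * θ ^ (n - 1) := by
    rw [derivative_sub, derivative_C, sub_zero, derivative_X_pow]
    simp
  rw [Algebra.discr_powerBasis_eq_norm, hfin, hB, hmin, hder, map_mul, Algebra.norm_algebraMap, hfin,
    map_pow, hnorm]
  obtain ⟨k, rfl⟩ : ∃ k, n = k + 1 := ⟨n - 1, by omega⟩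
  rw [Nat.add_sub_cancel, show k + 1 - 2 = k - 1 by omega]
  have hsign : (-1 : ℚ) ^ ((k + 1) * k / 2) * (-1) ^ ((k + 1) * k + k) = (-1) ^ (k * (k - 1) / 2) := by
    rcases k with _ | k
    · simp
    have h1 : (k + 1 + 1) * (k + 1) / 2 = (k + 1) * k / 2 + (k + 1) := by
      rw [show (k + 1 + 1) * (k + 1) = (k + 1) * k + (k + 1) * 2 by ring]
      exact Nat.add_mul_div_right _ _ two_pos
    have h2 : Even ((k + 1) + ((k + 1 + 1) * (k + 1) + (k + 1))) := by
      refine ⟨(k + 1) + (k + 1) * (k + 1 + 1) / 2, ?_⟩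
      have := Nat.div_mul_cancel (Nat.even_mul_succ_self (k + 1)).two_dvd
      nlinarith
    rw [h1, Nat.add_sub_cancel, ← pow_add, add_assoc, pow_add, h2.neg_one_pow, mul_one]
  rw [← hsign, mul_pow, ← pow_mul, neg_pow (a : ℚ) k, pow_add]
  ring

/-- The discriminant of the powers of `θ` multiplies every integer of `K` into `ℤ[θ]`. -/
theorem discr_mul_mem_adjoin (ha : Squarefree a) (hu : ¬ IsUnit a) {n : ℕ} (hn : n ≠ 0)
    (hθ : θ ^ n = (a : K)) (B : PowerBasis ℚ K) (hB : B.gen = θ) {x : K} (hx : IsIntegral ℤ x) :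
    (n : K) ^ n * (a : K) ^ (n - 1) * x ∈ Algebra.adjoin ℤ {θ} := by
  have hint : IsIntegral ℤ B.gen := by
    rw [hB]
    exact IsIntegral.of_pow (Nat.pos_of_ne_zero hn) (hθ ▸ isIntegral_algebraMap (x := a))
  have h := Algebra.discr_mul_isIntegral_mem_adjoin ℚ hint hx
  rw [discr_powers_eq ha hu hn hθ B hB, hB, Algebra.smul_def] at h
  have h2 : (algebraMap ℚ K) ((-1) ^ ((n - 1) * (n - 2) / 2) * (n : ℚ) ^ n * (a : ℚ) ^ (n - 1)) =
      (-1) ^ ((n - 1) * (n - 2) / 2) * ((n : K) ^ n * (a : K) ^ (n - 1)) := by simp [mul_assoc]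
  rw [h2, mul_assoc] at h
  have h3 := (Algebra.adjoin ℤ {θ}).mul_mem
    ((Algebra.adjoin ℤ {θ}).pow_mem ((Algebra.adjoin ℤ {θ}).neg_mem (one_mem _)) ((n - 1) * (n - 2) / 2)) h
  rwa [← mul_assoc, ← mul_pow, neg_one_mul, neg_neg, one_pow, one_mul] at h3

/-- `ℤ[θ]` is maximal at all primes dividing `a`, because `ℤ[θ] / θ = ℤ / a` is reduced. -/
theorem mem_adjoin_of_pow_mul_mem (ha : Squarefree a) {n : ℕ} (hn : n ≠ 0)
    (hθ : θ ^ n = (a : K)) {k : ℕ} {x : K} (hx : IsIntegral ℤ x)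
    (h : θ ^ k * x ∈ Algebra.adjoin ℤ {θ}) : x ∈ Algebra.adjoin ℤ {θ} := by
  have ha0 : (a : K) ≠ 0 := by exact_mod_cast ha.ne_zero
  have hθint : IsIntegral ℤ θ := IsIntegral.of_pow (Nat.pos_of_ne_zero hn) (hθ ▸ isIntegral_algebraMap (x := a))
  have hint : ∀ z : Algebra.adjoin ℤ {θ}, IsIntegral ℤ (z : K) := fun z =>
    (Algebra.adjoin_le (S := integralClosure ℤ K) (Set.singleton_subset_iff.mpr hθint)) z.2
  set t : Algebra.adjoin ℤ {θ} := ⟨θ, Algebra.self_mem_adjoin_singleton ℤ θ⟩ with ht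
  have htn : t ^ n = (a : Algebra.adjoin ℤ {θ}) := Subtype.ext (by simp [ht, hθ])
  have ht0 : t ≠ 0 := by
    intro h0
    rw [h0, zero_pow hn] at htn
    exact ha0 (by simpa using (congrArg Subtype.val htn).symm)
  -- an integer `b` divisible by `θ` is divisible by `a`: then `b ^ n / a` is integral and rational
  have key : ∀ b : ℤ, t ∣ (b : Algebra.adjoin ℤ {θ}) → a ∣ b := by
    rintro b ⟨w, hw⟩
    have h2 : algebraMap ℚ K ((b : ℚ) ^ n / a) = (w : K) ^ n := by
      have h3 := congrArg (fun z => ((z ^ n : Algebra.adjoin ℤ {θ}) : K)) hw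
      simp only [mul_pow, htn] at h3
      push_cast at h3
      rw [map_div₀, map_pow, map_intCast, map_intCast, h3]
      field_simp
    have h4 : IsIntegral ℤ ((b : ℚ) ^ n / a : ℚ) := by
      rw [← isIntegral_algebraMap_iff (algebraMap ℚ K).injective, h2]
      exact (hint w).pow n
    obtain ⟨c, hc⟩ := IsIntegrallyClosed.isIntegral_iff.mp h4
    have ha0' : (a : ℚ) ≠ 0 := by exact_mod_cast ha.ne_zero
    rw [eq_div_iff ha0'] at hc
    refine (ha.dvd_pow_iff_dvd hn).mp ⟨c, ?_⟩
    rw [mul_comm]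
    rw [eq_intCast] at hc
    exact_mod_cast hc.symm
  have hdecomp : ∀ z : Algebra.adjoin ℤ {θ}, ∃ b : ℤ, t ∣ z - b := by
    rintro ⟨z, hz⟩
    rw [Algebra.adjoin_singleton_eq_range_aeval] at hz
    obtain ⟨q, rfl⟩ := hz
    obtain ⟨q', hq'⟩ := X_sub_C_dvd_sub_C_eval (a := (0 : ℤ)) (p := q)
    refine ⟨q.eval 0, ⟨aeval θ q', aeval_mem_adjoin_singleton ℤ θ⟩, Subtype.ext ?_⟩
    have := congrArg (aeval θ) hq'
    simpa [ht] using this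
  have hrad : (Ideal.span {t}).IsRadical := by
    rintro z ⟨d, hd⟩
    rw [Ideal.mem_span_singleton] at hd ⊢
    obtain ⟨b, hb⟩ := hdecomp z
    have h1 : t ∣ ((b ^ (d + 1) : ℤ) : Algebra.adjoin ℤ {θ}) := by
      have h2 := hb.trans (sub_dvd_pow_sub_pow z (b : Algebra.adjoin ℤ {θ}) (d + 1))
      have h3 := dvd_sub (hd.mul_right z) h2
      rw [← pow_succ, sub_sub_cancel] at h3
      exact_mod_cast h3
    obtain ⟨c, rfl⟩ := (ha.dvd_pow_iff_dvd (Nat.succ_ne_zero d)).mp (key _ h1)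
    have h4 : t ∣ ((a * c : ℤ) : Algebra.adjoin ℤ {θ}) := by
      push_cast
      rw [← htn]
      exact (dvd_pow_self t hn).mul_right _
    simpa using dvd_add hb h4
  have := pow_mul_mem_of_isRadical (Algebra.adjoin ℤ {θ}) (Ideal.span {t}) hrad t 1
    (Ideal.mem_span_singleton_self t) ht0 ?_ k x hx hint h
  · simpa using this
  · intro z hz
    obtain ⟨w, hw⟩ := Ideal.mem_span_singleton.mp hz
    exact ⟨w, by rw [one_mul, hw]⟩

theorem discr_triangular {p : ℕ} (hp : p ≠ 0) (B : PowerBasis ℚ K) (G : ℕ → ℤ[X]) (hG : ∀ i, i < B.dim → (G i).Monic)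
    (hdeg : ∀ i, i < B.dim → (G i).natDegree = i) (h : ℕ → ℕ) :
    Algebra.discr ℚ (fun i : Fin B.dim => aeval B.gen (G i) / (p : K) ^ h i) *
      (p : ℚ) ^ (2 * ∑ i ∈ Finset.range B.dim, h i) = Algebra.discr ℚ B.basis := by
  set P : Matrix (Fin B.dim) (Fin B.dim) ℚ := Matrix.of fun k i => ((G i).coeff k : ℚ) / (p : ℚ) ^ h i with hP
  have h1 : (fun i : Fin B.dim => aeval B.gen (G i) / (p : K) ^ h i) =
      Matrix.vecMul B.basis (P.map (algebraMap ℚ K)) := by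
    funext i
    rw [aeval_eq_sum_range' (n := B.dim) (by rw [hdeg i i.2]; exact i.2), Finset.sum_range,
      Finset.sum_div]
    simp only [Matrix.vecMul, dotProduct, Matrix.map_apply, hP, Matrix.of_apply, B.basis_eq_pow]
    refine Finset.sum_congr rfl fun k _ => ?_
    rw [zsmul_eq_mul, map_div₀, map_intCast, map_pow, map_natCast]
    ring
  have hdet : P.det = ∏ i : Fin B.dim, ((p : ℚ) ^ h i)⁻¹ := by
    rw [Matrix.det_of_isUpperTriangular]
    · refine Finset.prod_congr rfl fun i _ => ?_
      have := hG i i.2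
      rw [Monic, leadingCoeff, hdeg i i.2] at this
      simp [hP, this]
    · intro k i hki
      have hki : i < k := hki
      simp only [hP, Matrix.of_apply]
      rw [coeff_eq_zero_of_natDegree_lt (by rw [hdeg i i.2]; exact hki)]
      simp
  have hp' : (p : ℚ) ≠ 0 := by exact_mod_cast hp
  rw [h1, Algebra.discr_of_matrix_vecMul, hdet, Finset.prod_inv_distrib, Finset.prod_pow_eq_pow_sum,
    Finset.sum_range, mul_comm 2, pow_mul (p : ℚ)]
  field_simp

theorem sum_blockIdx {p s m : ℕ} (hp : 0 < p) :
    ∑ i ∈ Finset.range (p ^ s), blockIdx p s m i = ∑ t ∈ Finset.Icc 1 m, p ^ (s - t) := by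
  have h1 : ∀ i, blockIdx p s m i =
      ∑ t ∈ Finset.Icc 1 m, if p ^ s - p ^ (s - t) ≤ i then 1 else 0 := by
    intro i
    rw [← Finset.sum_filter, Finset.sum_const, smul_eq_mul, mul_one]
    have : (Finset.Icc 1 m).filter (fun t => p ^ s - p ^ (s - t) ≤ i) =
        Finset.Icc 1 (blockIdx p s m i) := by
      ext t
      simp only [Finset.mem_filter, Finset.mem_Icc, le_blockIdx_iff hp]
      tauto
    rw [this, Nat.card_Icc, Nat.add_sub_cancel]
  simp_rw [h1]
  rw [Finset.sum_comm]
  refine Finset.sum_congr rfl fun t _ => ?_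
  rw [← Finset.sum_filter, Finset.sum_const, smul_eq_mul, mul_one]
  have h2 : p ^ (s - t) ≤ p ^ s := Nat.pow_le_pow_right hp (Nat.sub_le _ _)
  have : (Finset.range (p ^ s)).filter (fun i => p ^ s - p ^ (s - t) ≤ i) =
      Finset.Ico (p ^ s - p ^ (s - t)) (p ^ s) := by
    ext i
    simp only [Finset.mem_filter, Finset.mem_range, Finset.mem_Ico]
    tauto
  rw [this, Nat.card_Ico]
  omega
end

/-! ### The ring of integers and the discriminant -/

section
variable {K : Type*} [Field K] {a : ℤ} {p s m : ℕ} {θ : K}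

theorem quotBasis_eq_aeval_monic_div (hp : 0 < p) (hms : m ≤ s) {i : ℕ} :
    (X ^ (i - (p ^ s - p ^ (s - blockIdx p s m i))) * rungProd a p s (blockIdx p s m i)).Monic ∧
    (X ^ (i - (p ^ s - p ^ (s - blockIdx p s m i))) *
      rungProd a p s (blockIdx p s m i)).natDegree = i ∧
    quotBasis a p s θ m i = aeval θ (X ^ (i - (p ^ s - p ^ (s - blockIdx p s m i))) *
      rungProd a p s (blockIdx p s m i)) / (p : K) ^ blockIdx p s m i := by
  obtain ⟨h1, h2⟩ := (le_blockIdx_iff (s := s) (m := m) (i := i) hp).mp le_rfl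
  have hm := rungProd_monic (a := a) hp (h1.trans hms)
  have hd := natDegree_rungProd (a := a) hp (h1.trans hms)
  refine ⟨(monic_X_pow _).mul hm, ?_, ?_⟩
  · rw [(monic_X_pow _).natDegree_mul hm, natDegree_X_pow]
    omega
  · rw [quotBasis, quotElt, map_mul, map_pow, aeval_X, mul_div_assoc]

/-- The discriminant of `K`, once `quotAlg` is known to be the ring of integers. -/
theorem discr_mul_pow_eq [NumberField K] (hp : p.Prime) (ha : Squarefree a) (hu : ¬ IsUnit a)
    (hθ : θ ^ p ^ s = (a : K)) (B : PowerBasis ℚ K) (hB : B.gen = θ) (hms : m ≤ s)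
    (hspan : ∀ x ∈ quotAlg a p s θ m, x ∈
      Submodule.span ℤ (Set.range fun i : Fin (p ^ s) => quotBasis a p s θ m i))
    (hint : ∀ x ∈ quotAlg a p s θ m, IsIntegral ℤ x)
    (hmax : ∀ x, IsIntegral ℤ x → x ∈ quotAlg a p s θ m) :
    (NumberField.discr K : ℚ) * (p : ℚ) ^ (2 * ∑ t ∈ Finset.Icc 1 m, p ^ (s - t)) =
      (-1) ^ ((p ^ s - 1) * (p ^ s - 2) / 2) * (p : ℚ) ^ (s * p ^ s) * (a : ℚ) ^ (p ^ s - 1) := by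
  have hn : p ^ s ≠ 0 := (pow_pos hp.pos s).ne'
  have hdim : B.dim = p ^ s := by
    rw [← B.natDegree_minpoly, hB, minpoly_eq_X_pow_sub_C ha hu hn hθ, natDegree_X_pow_sub_C]
  have hdisc := discr_powers_eq ha hu hn hθ B hB
  have htri := discr_triangular hp.ne_zero B
    (fun i => X ^ (i - (p ^ s - p ^ (s - blockIdx p s m i))) * rungProd a p s (blockIdx p s m i))
    (fun i _ => (quotBasis_eq_aeval_monic_div (θ := θ) hp.pos hms).1)
    (fun i _ => (quotBasis_eq_aeval_monic_div (θ := θ) hp.pos hms).2.1) (blockIdx p s m)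
  rw [← hdim] at hspan
  have hω : (fun i : Fin B.dim => aeval B.gen (X ^ ((i : ℕ) - (p ^ s - p ^ (s - blockIdx p s m i))) *
      rungProd a p s (blockIdx p s m i)) / (p : K) ^ blockIdx p s m i) =
      fun i : Fin B.dim => quotBasis a p s θ m i := by
    funext i
    rw [hB, (quotBasis_eq_aeval_monic_div hp.pos hms).2.2]
  have hsum : ∑ i ∈ Finset.range B.dim, blockIdx p s m i = ∑ t ∈ Finset.Icc 1 m, p ^ (s - t) := by
    rw [hdim, sum_blockIdx hp.pos]
  rw [hω, hsum] at htri
  set ω : Fin B.dim → K := fun i => quotBasis a p s θ m i with hωdef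
  have hli : LinearIndependent ℚ ω := by
    by_contra h
    rw [Algebra.discr_zero_of_not_linearIndependent ℚ h, zero_mul] at htri
    exact Algebra.discr_not_zero_of_basis ℚ B.basis htri.symm
  have : Nonempty (Fin B.dim) := ⟨⟨0, B.dim_pos⟩⟩
  set b := basisOfLinearIndependentOfCardEqFinrank hli (by rw [Fintype.card_fin, B.finrank]) with hb
  have hbω : ⇑b = ω := coe_basisOfLinearIndependentOfCardEqFinrank _ _
  have hωint : ∀ i, IsIntegral ℤ (ω i) := by
    intro i
    obtain ⟨h1, -⟩ := (le_blockIdx_iff (s := s) (m := m) (i := (i : ℕ)) hp.pos).mp le_rfl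
    exact hint _ (mul_mem (pow_mem self_mem_quotAlg _) (quotElt_mem_quotAlg h1))
  have key : Algebra.discr ℚ (NumberField.integralBasis K) = Algebra.discr ℚ b := by
    refine Algebra.discr_eq_discr_of_toMatrix_coeff_isIntegral K ?_ ?_
    · intro i j
      rw [Module.Basis.toMatrix_apply, hbω]
      have := NumberField.integralBasis_repr_apply K ⟨ω j, hωint j⟩ i
      rw [show algebraMap (NumberField.RingOfIntegers K) K ⟨ω j, hωint j⟩ = ω j from rfl] at this
      rw [this]
      exact isIntegral_algebraMap
    · intro i j
      rw [Module.Basis.toMatrix_apply]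
      have h1 : NumberField.integralBasis K j ∈ Submodule.span ℤ (Set.range b) := by
        rw [hbω]
        refine hspan _ (hmax _ ?_)
        rw [NumberField.integralBasis_apply]
        exact NumberField.RingOfIntegers.isIntegral_coe _
      obtain ⟨c, hc⟩ := (b.mem_span_iff_repr_mem ℤ _).mp h1 i
      rw [← hc]
      exact isIntegral_algebraMap
  rw [NumberField.coe_discr, key, hbω, htri, hdisc]
  push_cast
  rw [pow_mul]

theorem p_pow_mul_mem_adjoin_of_isIntegral [NumberField K] (hp : p.Prime) (ha : Squarefree a)
    (hu : ¬ IsUnit a)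
    (hθ : θ ^ p ^ s = (a : K)) (B : PowerBasis ℚ K) (hB : B.gen = θ) {x : K}
    (hx : IsIntegral ℤ x) : (p : K) ^ (s * p ^ s) * x ∈ Algebra.adjoin ℤ {θ} := by
  have hn : p ^ s ≠ 0 := (pow_pos hp.pos s).ne'
  have h := discr_mul_mem_adjoin ha hu hn hθ B hB hx
  refine mem_adjoin_of_pow_mul_mem ha hn hθ (k := p ^ s * (p ^ s - 1)) ?_ ?_
  · have h1 : IsIntegral ℤ ((p : K) ^ (s * p ^ s)) := by
      have := isIntegral_algebraMap (R := ℤ) (A := K) (x := (p : ℤ) ^ (s * p ^ s))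
      simpa using this
    exact h1.mul hx
  · rw [pow_mul, hθ, pow_mul]
    push_cast at h
    convert h using 1
    ring

/-- If `p ∣ a`, then maximality at the primes dividing `a` includes `p`, and `ℤ[θ]` is the full ring of
integers. -/
theorem mem_adjoin_of_isIntegral [NumberField K] (hp : p.Prime) (ha : Squarefree a)
    (hu : ¬ IsUnit a) (hpa : (p : ℤ) ∣ a ∨ s = 0)
    (hθ : θ ^ p ^ s = (a : K)) (B : PowerBasis ℚ K) (hB : B.gen = θ) {x : K}
    (hx : IsIntegral ℤ x) : x ∈ Algebra.adjoin ℤ {θ} := by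
  have hn : p ^ s ≠ 0 := (pow_pos hp.pos s).ne'
  have h := p_pow_mul_mem_adjoin_of_isIntegral hp ha hu hθ B hB hx
  rcases hpa with ⟨c, hc⟩ | rfl
  · refine mem_adjoin_of_pow_mul_mem ha hn hθ (k := p ^ s * (s * p ^ s)) hx ?_
    have h1 := (Algebra.adjoin ℤ {θ}).mul_mem
      (pow_mem (intCast_mem (Algebra.adjoin ℤ {θ}) c) (s * p ^ s)) h
    rw [pow_mul, hθ, hc]
    push_cast
    convert h1 using 1
    ring
  · simpa using h

/-- The `p`-adic valuation of `a - a ^ p ^ s` is that of `a ^ (p - 1) - 1`. -/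
theorem exists_sub_pow_eq (hp : p.Prime) (hpa : ¬ (p : ℤ) ∣ a) (hs : s ≠ 0)
    (h0 : a ^ (p - 1) - 1 ≠ 0) : ∃ u : ℤ, ¬ (p : ℤ) ∣ u ∧
      a - a ^ p ^ s = p ^ padicValInt p (a ^ (p - 1) - 1) * u := by
  have := Fact.mk hp
  have hpi := Nat.prime_iff_prime_int.mp hp
  obtain ⟨w, hw⟩ := padicValInt_dvd (p := p) (a ^ (p - 1) - 1)
  have hpw : ¬ (p : ℤ) ∣ w := by
    rintro ⟨w', rfl⟩
    have : (p : ℤ) ^ (padicValInt p (a ^ (p - 1) - 1) + 1) ∣ a ^ (p - 1) - 1 :=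
      ⟨w', by rw [pow_succ, mul_assoc, ← hw]⟩
    rcases (padicValInt_dvd_iff _ _).mp this with h | h
    · exact h0 h
    · omega
  set t := ∑ i ∈ Finset.range s, p ^ i with ht
  have h1 : t * (p - 1) + 1 = p ^ s := by
    have := geom_sum_mul_add (p - 1) s
    rwa [Nat.sub_add_cancel hp.one_le] at this
  have h2 : (p : ℤ) ∣ (t : ℤ) - 1 := by
    obtain ⟨s, rfl⟩ := Nat.exists_eq_succ_of_ne_zero hs
    refine ⟨∑ i ∈ Finset.range s, (p : ℤ) ^ i, ?_⟩
    rw [ht, Finset.sum_range_succ', Finset.mul_sum]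
    push_cast
    simp [pow_succ, mul_comm]
  have h3 : (p : ℤ) ∣ (∑ i ∈ Finset.range t, (a ^ (p - 1)) ^ i) - t := by
    have : (∑ i ∈ Finset.range t, (a ^ (p - 1)) ^ i) - t =
        ∑ i ∈ Finset.range t, (a ^ (i * (p - 1)) - 1) := by
      rw [Finset.sum_sub_distrib]
      simp [← pow_mul, mul_comm]
    rw [this]
    exact Finset.dvd_sum fun i _ => dvd_pow_sub_one hp hpa i
  refine ⟨-(a * (w * ∑ i ∈ Finset.range t, (a ^ (p - 1)) ^ i)), ?_, ?_⟩
  · rw [dvd_neg]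
    refine hpi.not_dvd_mul hpa (hpi.not_dvd_mul hpw fun h => hpi.not_dvd_one ?_)
    have := dvd_sub (dvd_sub h h3) h2
    simpa using this
  · have h4 := mul_geom_sum (a ^ (p - 1)) t
    rw [← h1, pow_succ, mul_comm t, pow_mul]
    linear_combination a * h4 - (a * ∑ i ∈ Finset.range t, (a ^ (p - 1)) ^ i) * hw

/-- The discriminant formula without case distinction: by truncated subtraction, the sum is empty when
the valuation is `0` or `1`. -/
theorem discr_pure_prime_pow_mul [NumberField K] (hp : p.Prime) (ha : Squarefree a)
    (ha1 : a ≠ 1) (ha2 : a ≠ -1) (hθ : θ ^ p ^ s = (a : K))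
    (hK : IntermediateField.adjoin ℚ {θ} = ⊤) :
    (NumberField.discr K : ℚ) * (p : ℚ) ^ (2 * ∑ t ∈ Finset.Icc 1
        (min (padicValInt p (a ^ (p - 1) - 1) - 1) s), p ^ (s - t)) =
      (-1) ^ ((p ^ s - 1) * (p ^ s - 2) / 2) * (p : ℚ) ^ (s * p ^ s) * (a : ℚ) ^ (p ^ s - 1) := by
  have hn : p ^ s ≠ 0 := (pow_pos hp.pos s).ne'
  have hu : ¬ IsUnit a := by rw [Int.isUnit_iff]; tauto
  have hintθ : IsIntegral ℚ θ := Algebra.IsIntegral.isIntegral θ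
  have hadj : Algebra.adjoin ℚ {θ} = ⊤ := by
    rw [← IntermediateField.adjoin_simple_toSubalgebra_of_isAlgebraic hintθ.isAlgebraic, hK,
      IntermediateField.top_toSubalgebra]
  set B := PowerBasis.ofAdjoinEqTop hintθ hadj with hBdef
  have hB : B.gen = θ := PowerBasis.ofAdjoinEqTop_gen hintθ hadj
  have h0 : a ^ (p - 1) - 1 ≠ 0 := by
    intro h
    exact hu ((isUnit_pow_iff (Nat.sub_ne_zero_of_lt hp.one_lt)).mp
      (by rw [sub_eq_zero.mp h]; exact isUnit_one))
  by_cases hpa : (p : ℤ) ∣ a ∨ s = 0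
  · have hm : min (padicValInt p (a ^ (p - 1) - 1) - 1) s = 0 := by
      rcases hpa with h | rfl
      · have := Fact.mk hp
        rw [padicValInt.eq_zero_of_not_dvd, Nat.zero_sub, Nat.zero_min]
        intro h'
        have h1 := dvd_sub (dvd_pow h (Nat.sub_ne_zero_of_lt hp.one_lt)) h'
        rw [sub_sub_cancel] at h1
        exact (Nat.prime_iff_prime_int.mp hp).not_dvd_one h1
      · exact Nat.min_zero _
    rw [hm]
    refine discr_mul_pow_eq hp ha hu hθ B hB (Nat.zero_le s) (fun x hx => ?_) (fun x hx => ?_)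
      fun x hx => ?_
    · exact quotSpan_le_span_quotBasis (r := 0) (u := 0) hp hθ (fun h => (h rfl).elim) (Nat.zero_le s) le_rfl
        (quotAlg_le_quotSpan (r := 0) (u := 0) hp hθ (fun h => (h rfl).elim) (Nat.zero_le s) le_rfl x hx)
    · exact isIntegral_of_mem_quotAlg (r := 0) (u := 0) hp hθ (fun h => (h rfl).elim) (Nat.zero_le s) le_rfl hx
    · exact Algebra.adjoin_mono (Set.singleton_subset_iff.mpr (Set.mem_insert _ _))
        (mem_adjoin_of_isIntegral hp ha hu hpa hθ B hB hx)
  · push Not at hpa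
    obtain ⟨hpa, hs⟩ := hpa
    obtain ⟨u, hpu, hau⟩ := exists_sub_pow_eq hp hpa hs h0
    have hv : 1 ≤ padicValInt p (a ^ (p - 1) - 1) := by
      have := Fact.mk hp
      have h1 := dvd_pow_sub_one hp hpa 1
      rw [one_mul, ← pow_one (p : ℤ), padicValInt_dvd_iff] at h1
      exact h1.resolve_left h0
    obtain ⟨r, hr⟩ := Nat.exists_eq_add_of_le' hv
    rw [hr] at hau ⊢
    rw [Nat.add_sub_cancel]
    have hms : min r s ≤ s := min_le_right _ _
    have hmr : min r s ≤ r := min_le_left _ _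
    have hθa : θ ≠ a := by
      intro h
      rw [h] at hθ
      have h1 : a ^ p ^ s = a := by exact_mod_cast hθ
      rw [h1, sub_self] at hau
      have h2 := (mul_eq_zero.mp hau.symm).resolve_left
        (pow_ne_zero _ (by exact_mod_cast hp.ne_zero))
      exact hpu (h2 ▸ dvd_zero _)
    refine discr_mul_pow_eq hp ha hu hθ B hB hms (fun x hx => ?_) (fun x hx => ?_) fun x hx => ?_
    · exact quotSpan_le_span_quotBasis hp hθ (fun _ => hau) hms hmr
        (quotAlg_le_quotSpan hp hθ (fun _ => hau) hms hmr x hx)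
    · exact isIntegral_of_mem_quotAlg hp hθ (fun _ => hau) hms hmr hx
    · exact mem_quotAlg_of_isIntegral hp hpa hθ hθa hau hpu hx
        (Algebra.adjoin_mono (Set.singleton_subset_iff.mpr (Set.mem_insert _ _))
          (p_pow_mul_mem_adjoin_of_isIntegral hp ha hu hθ B hB hx))
end

theorem corollary2p22 (p : ℕ) (hp : p.Prime) (s : ℕ) (a : ℤ) (ha : Squarefree a)
    (ha1 : a ≠ 1) (ha2 : a ≠ -1)
    (K : Type*) [Field K] [NumberField K] (θ : K) (hθ : θ ^ p ^ s = (a : K))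
    (hK : IntermediateField.adjoin ℚ {θ} = ⊤)
    (r : ℤ) (hr : r = (padicValInt p (a ^ (p - 1) - 1) : ℤ) - 1)
    (ν : ℤ)
    (hν : ν = if 0 < r
      then (s : ℤ) * (p : ℤ) ^ s - 2 * ∑ j ∈ Finset.Icc 1 (min r.toNat s), (p : ℤ) ^ (s - j)
      else (s : ℤ) * (p : ℤ) ^ s) :
    ((NumberField.discr K : ℤ) : ℚ) =
        (-1) ^ ((p ^ s - 1) * (p ^ s - 2) / 2) * (p : ℚ) ^ ν * (a : ℚ) ^ (p ^ s - 1) ∧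
    (p = 2 → s = 3 →
      ((a ≡ 2 [ZMOD 4] ∨ a ≡ 3 [ZMOD 4]) → NumberField.discr K = -2 ^ 24 * a ^ 7) ∧
      ((a ≡ 5 [ZMOD 16] ∨ a ≡ 13 [ZMOD 16]) → NumberField.discr K = -2 ^ 16 * a ^ 7) ∧
      (a ≡ 9 [ZMOD 16] → NumberField.discr K = -2 ^ 12 * a ^ 7) ∧
      (a ≡ 1 [ZMOD 16] → NumberField.discr K = -2 ^ 10 * a ^ 7)) := by
  have h := discr_pure_prime_pow_mul hp ha ha1 ha2 hθ hK
  constructor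
  · have hp0 : (p : ℚ) ≠ 0 := by exact_mod_cast hp.ne_zero
    have hrt : r.toNat = padicValInt p (a ^ (p - 1) - 1) - 1 := by omega
    -- for `r ≤ 0` the sum is empty, so that the two cases agree
    have hν' : ν + ((2 * ∑ t ∈ Finset.Icc 1 (min (padicValInt p (a ^ (p - 1) - 1) - 1) s),
        p ^ (s - t) : ℕ) : ℤ) = ((s * p ^ s : ℕ) : ℤ) := by
      rw [hν, ← hrt]
      push_cast
      split_ifs with h0
      · ring
      · rw [Int.toNat_of_nonpos (not_lt.mp h0), Nat.zero_min]
        simp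
    apply mul_right_cancel₀ (pow_ne_zero (2 * ∑ t ∈ Finset.Icc 1
        (min (padicValInt p (a ^ (p - 1) - 1) - 1) s), p ^ (s - t)) hp0)
    rw [h, ← zpow_natCast (p : ℚ) (s * p ^ s), ← hν', zpow_add₀ hp0, zpow_natCast]
    ring
  · rintro rfl rfl
    have h0 : a - 1 ≠ 0 := sub_ne_zero.mpr ha1
    have hle : ∀ k : ℕ, k ≤ padicValInt 2 (a - 1) ↔ (2 : ℤ) ^ k ∣ a - 1 := by
      intro k
      have := padicValInt_dvd_iff (p := 2) k (a - 1)
      simp only [Nat.cast_ofNat, h0, false_or] at this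
      exact this.symm
    have h1 := hle 1
    have h2 := hle 2
    have h3 := hle 3
    have h4 := hle 4
    simp only [Nat.add_one_sub_one, pow_one] at h
    set v := padicValInt 2 (a - 1)
    norm_num at h1 h2 h3 h4
    have key : ∀ m e : ℕ, min (v - 1) 3 = m → e + 2 * ∑ t ∈ Finset.Icc 1 m, 2 ^ (3 - t) = 24 →
        NumberField.discr K = -2 ^ e * a ^ 7 := by
      intro m e hm he
      rw [hm] at h
      have h5 : NumberField.discr K * 2 ^ (2 * ∑ t ∈ Finset.Icc 1 m, 2 ^ (3 - t)) =
          -2 ^ 24 * a ^ 7 := by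
        have h6 : (-1 : ℚ) ^ ((2 ^ 3 - 1) * (2 ^ 3 - 2) / 2) = -1 := by norm_num
        rw [h6] at h
        norm_num at h ⊢
        exact_mod_cast h
      apply mul_right_cancel₀ (pow_ne_zero (2 * ∑ t ∈ Finset.Icc 1 m, 2 ^ (3 - t))
        (two_ne_zero (α := ℤ)))
      rw [h5, ← he, pow_add]
      ring
    simp only [Int.ModEq]
    refine ⟨fun hc => key 0 24 (by omega) (by decide), fun hc => key 1 16 (by omega) (by decide),
      fun hc => key 2 12 (by omega) (by decide), fun hc => key 3 10 (by omega) (by decide)⟩
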